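/- **Setting.** Let $W\subseteq\mathbb R^2$ be open and let $X\subseteq\mathbb R$ be its projection to the $x$-axis. A coefficient function on $W$ is a real function that is $C^\infty$ on a dense open subset of $W$; two of them are identified if they agree on a dense open subset of $W$ (every differential field of such functions, for example the field of rational functions, is covered). Coefficient functions on $X$ are defined likewise, and are regarded as functions on $W$ that do not depend on $y$. $L(x,y)$ denotes a linear ordinary differential operator $\sum_i a_i(x,y)D^i$, $D=d/dx$, with coefficients on $W$, and $R(x)$ one with coefficients on $X$; products of operators are compositions. Write $F(x)=L(x,y_0)$ if, for each coefficient $a$ of $L$, some smooth representative of $a$ on a dense open subset of $W$ is defined at $(x,y_0)$ for a dense set of $x\in X$, and its values there give the corresponding coefficient of $F$. A multiintegral is an expression $\mathcal J=L_1(x,y)\varphi_1(x)+\dots+L_k(x,y)\varphi_k(x)$ with arbitrary $C^\infty$ functions $\varphi_j$ on $X$; its kernel is the set of columns $(\varphi_1,\dots,\varphi_k)^t$ for which it vanishes identically as a function of $(x,y)$. It is *kernel-irreducible* if its kernel contains only the zero column. The kernel of an operator matrix $\widehat R(x)$ is the set of columns of $C^\infty$ functions on $X$ with $\widehat R\,\mathring\varphi=0$.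 (Vanishing is understood on a dense open set, where all coefficients are defined.) **Algorithm RI** (input: a nonzero operator $N(x,y)$). Choose $y_1$ such that $B(x)=N(x,y_1)$ is defined with invertible leading coefficient. While $B$ has positive order and is not a right divisor of $N(x,y)$, choose a further point $y_{s+1}$ and replace $B$ by the right greatest common divisor of $N(x,y_{s+1})$ and $B$, found by the Euclidean algorithm with right division (all divisors having invertible leading coefficients); reverse substitution gives operators $P_i(x)$ with $B=\sum_i P_i(x)N(x,y_i)$. If $B$ has order $0$ and is invertible, the output may be $K=N$, $R=1$, with $P_i$ replaced by $B^{-1}P_i$; if $N(x,y)=K(x,y)B(x)$, the output may be $K$ and $R=B$, with the $P_i$ as found. The output $K,R$ satisfies $N(x,y)=K(x,y)R(x)$, and the points $y_i$ and operators $P_i(x)$ are kept. **Algorithm RMI** (input: a row $\overline L=(L_1,\dots,L_k)$). The operators are processed in turn, starting with $p=0$. At each step there are operators $K_1,\dots,K_p$, each with its points $y_{i,l}$ and operators $P_{i,l}(x)$ from RI, operators $S_{iq}(x)$ $(i<q\le p)$, a row $M_1,\dots,M_p$ and a matrix with $p$ rows. For the next operator $L_j$ put $N=L_j$; for $i=1,\dots,p$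 in turn put $T_i(x)=\sum_l P_{i,l}(x)N(x,y_{i,l})$ and replace $N$ by $N-K_iT_i$. If the final $N$ is $0$, then $p$ is unchanged and the new column $(R_{1j},\dots,R_{pj})^t$ is determined by $R_{ij}+\sum_{i<q\le p}S_{iq}R_{qj}=T_i$. If $N\ne0$, apply RI to $N$ to get $N=K_{p+1}R_{p+1,j}$ with its points and operators, choose $S_{1,p+1}(x),\dots,S_{p,p+1}(x)$ arbitrarily, put $M_{p+1}=\sum_{i\le p}K_iS_{i,p+1}+K_{p+1}$, determine $R_{1j},\dots,R_{pj}$ by $R_{ij}+\sum_{i<q\le p+1}S_{iq}R_{qj}=T_i$, fill the new row with zeros in the earlier columns, and increase $p$ by one. The output is the row $\overline M=(M_1,\dots,M_p)$ and the $p\times k$ echelon matrix $\widehat R=(R_{ij}(x))$. **Statement.** Let $\overline M=(M_1,\dots,M_p)$ and $\widehat R(x)$ be the output of any run of RMI on an operator row $\overline L=(L_1,\dots,L_k)$, for arbitrary admissible choices made in the run. Then the multiintegral $M_1(x,y)\psi_1(x)+\dots+M_p(x,y)\psi_p(x)$ is kernel-irreducible, and the kernel of the multiintegral $L_1(x,y)\varphi_1(x)+\dots+L_k(x,y)\varphi_k(x)$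 coincides with the kernel of the matrix $\widehat R(x)$. -/

import Mathlib

open scoped Polynomial ContDiff
open Filter TopologicalSpace

noncomputable section

namespace EulerIntegral

/-! ### Coefficient functions

Coefficients such as rational functions are not defined everywhere: a coefficient on an open set `W`
is a function that is smooth on some dense open subset of `W`, and two of them are identified when
they agree on a dense open subset of `W`.  These classes form a commutative differential ring, which
contains every differential field of functions on `W`.  -/

section Coefficients

variable {E : Type*} [NormedAddCommGroup E]

/-- `V` is a dense open subset of the open set `W`. -/
def DenseIn (V W : Opens E) : Prop :=
  V ≤ W ∧ (W : Set E) ⊆ closure (V : Set E)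

theorem DenseIn.refl (W : Opens E) : DenseIn W W := ⟨le_rfl, subset_closure⟩

theorem DenseIn.inf {V V' W : Opens E} (h : DenseIn V W) (h' : DenseIn V' W) :
    DenseIn (V ⊓ V') W := by
  refine ⟨inf_le_left.trans h.1, fun x hx => mem_closure_iff.2 fun O hO hxO => ?_⟩
  obtain ⟨a, ha, haV⟩ := mem_closure_iff.1 (h.2 hx) O hO hxO
  obtain ⟨b, hb, hbV⟩ := mem_closure_iff.1 (h'.2 (h.1 haV)) (O ∩ V) (hO.inter V.isOpen) ⟨ha, haV⟩
  exact ⟨b, hb.1, hb.2, hbV⟩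

/-- The filter of sets that contain a dense open subset of `W`. -/
def generic (W : Opens E) : Filter E where
  sets := {s | ∃ V, DenseIn V W ∧ (V : Set E) ⊆ s}
  univ_sets := ⟨W, DenseIn.refl W, Set.subset_univ _⟩
  sets_of_superset := fun ⟨V, hV, h⟩ hs => ⟨V, hV, h.trans hs⟩
  inter_sets := fun ⟨V, hV, h⟩ ⟨V', hV', h'⟩ =>
    ⟨V ⊓ V', hV.inf hV', fun _ hx => ⟨h hx.1, h' hx.2⟩⟩

theorem mem_generic {W : Opens E} {s : Set E} :
    s ∈ generic W ↔ ∃ V, DenseIn V W ∧ (V : Set E) ⊆ s := Iff.rfl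

variable [NormedSpace ℝ E]

/-- The ring of coefficient functions on `W`: real functions that are smooth on a dense open subset
of `W`, modulo equality on a dense open subset of `W`. -/
def Coef (W : Opens E) : Subring (Germ (generic W) ℝ) where
  carrier := {a | ∃ (f : E → ℝ) (V : Opens E), DenseIn V W ∧ ContDiffOn ℝ ∞ f V ∧
    a = (f : Germ (generic W) ℝ)}
  one_mem' := ⟨fun _ => 1, W, DenseIn.refl W, contDiffOn_const, rfl⟩
  zero_mem' := ⟨fun _ => 0, W, DenseIn.refl W, contDiffOn_const, rfl⟩
  neg_mem' := by
    rintro _ ⟨f, V, hV, hf, rfl⟩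
    exact ⟨-f, V, hV, hf.neg, rfl⟩
  add_mem' := by
    rintro _ _ ⟨f, V, hV, hf, rfl⟩ ⟨g, V', hV', hg, rfl⟩
    exact ⟨f + g, V ⊓ V', hV.inf hV', (hf.mono fun _ h => h.1).add (hg.mono fun _ h => h.2), rfl⟩
  mul_mem' := by
    rintro _ _ ⟨f, V, hV, hf, rfl⟩ ⟨g, V', hV', hg, rfl⟩
    exact ⟨f * g, V ⊓ V', hV.inf hV', (hf.mono fun _ h => h.1).mul (hg.mono fun _ h => h.2), rfl⟩

/-- The derivative in the direction `v` of a function class on `W`. -/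
def germDeriv (W : Opens E) (v : E) : Germ (generic W) ℝ → Germ (generic W) ℝ :=
  Germ.map' (fun f z => fderiv ℝ f z v) (by
    rintro f g ⟨V, hV, h⟩
    refine ⟨V, hV, fun z hz => ?_⟩
    have : f =ᶠ[nhds z] g := by
      filter_upwards [V.isOpen.mem_nhds hz] with w hw using h hw
    show fderiv ℝ f z v = fderiv ℝ g z v
    rw [this.fderiv_eq])

theorem germDeriv_mem {W : Opens E} (v : E) {a : Germ (generic W) ℝ} (ha : a ∈ Coef W) :
    germDeriv W v a ∈ Coef W := by
  obtain ⟨f, V, hV, hf, rfl⟩ := ha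
  exact ⟨fun z => fderiv ℝ f z v, V, hV,
    (hf.fderiv_of_isOpen V.isOpen (by simp)).clm_apply contDiffOn_const, rfl⟩

/-- Differentiation in the direction `v`, as a derivation of the ring of coefficient functions. -/
def coefDeriv (W : Opens E) (v : E) : Derivation ℤ (Coef W) (Coef W) :=
  Derivation.mk'
    (AddMonoidHom.mk' (fun a : Coef W => (⟨germDeriv W v a, germDeriv_mem v a.2⟩ : Coef W)) (by
      rintro ⟨_, f, V, hV, hf, rfl⟩ ⟨_, g, V', hV', hg, rfl⟩
      refine Subtype.ext (Germ.coe_eq.2 ⟨V ⊓ V', hV.inf hV', fun z hz => ?_⟩)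
      have h1 : DifferentiableAt ℝ f z :=
        (hf.differentiableOn (by simp)).differentiableAt (V.isOpen.mem_nhds hz.1)
      have h2 : DifferentiableAt ℝ g z :=
        (hg.differentiableOn (by simp)).differentiableAt (V'.isOpen.mem_nhds hz.2)
      show fderiv ℝ (f + g) z v = fderiv ℝ f z v + fderiv ℝ g z v
      rw [fderiv_add h1 h2]; rfl)).toIntLinearMap (by
    rintro ⟨_, f, V, hV, hf, rfl⟩ ⟨_, g, V', hV', hg, rfl⟩
    refine Subtype.ext (Germ.coe_eq.2 ⟨V ⊓ V', hV.inf hV', fun z hz => ?_⟩)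
    have h1 : DifferentiableAt ℝ f z :=
      (hf.differentiableOn (by simp)).differentiableAt (V.isOpen.mem_nhds hz.1)
    have h2 : DifferentiableAt ℝ g z :=
      (hg.differentiableOn (by simp)).differentiableAt (V'.isOpen.mem_nhds hz.2)
    show fderiv ℝ (f * g) z v = f z * fderiv ℝ g z v + g z * fderiv ℝ f z v
    rw [fderiv_mul h1 h2]; rfl)

end Coefficients

/-- `d/dx` on functions of `x`. -/
instance coefDifferential₁ (X : Opens ℝ) : Differential (Coef X) := ⟨coefDeriv X 1⟩

/-- `∂/∂x` on functions of `(x, y)`. -/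
instance coefDifferential₂ (W : Opens (ℝ × ℝ)) : Differential (Coef W) := ⟨coefDeriv W (1, 0)⟩

/-- The set of the `x` that occur in a domain of the plane. -/
def xProj (W : Opens (ℝ × ℝ)) : Opens ℝ := ⟨Prod.fst '' (W : Set (ℝ × ℝ)), isOpenMap_fst _ W.isOpen⟩

theorem tendsto_fst_generic (W : Opens (ℝ × ℝ)) :
    Tendsto Prod.fst (generic W) (generic (xProj W)) := by
  rintro s ⟨V, hV, hs⟩
  refine ⟨⟨(W : Set (ℝ × ℝ)) ∩ Prod.fst ⁻¹' V, W.isOpen.inter (V.isOpen.preimage continuous_fst)⟩,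
    ⟨fun _ h => h.1, fun z hz => mem_closure_iff.2 fun O hO hzO => ?_⟩, fun z hz => hs hz.2⟩
  obtain ⟨_, ⟨p, hp, rfl⟩, hV'⟩ := mem_closure_iff.1 (hV.2 ⟨z, hz, rfl⟩) (Prod.fst '' (O ∩ W))
    (isOpenMap_fst _ (hO.inter W.isOpen)) ⟨z, ⟨hzO, hz⟩, rfl⟩
  exact ⟨p, hp.1, hp.2, hV'⟩

/-- A function of `x` alone, regarded as a function of `(x, y)`. -/
def ofX (W : Opens (ℝ × ℝ)) : Coef (xProj W) →+* Coef W where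
  toFun b := ⟨(b : Germ (generic (xProj W)) ℝ).compTendsto Prod.fst (tendsto_fst_generic W), by
    obtain ⟨_, f, V, hV, hf, rfl⟩ := b
    obtain ⟨V', hV', h⟩ := tendsto_fst_generic W (show (V : Set ℝ) ∈ _ from ⟨V, hV, subset_rfl⟩)
    exact ⟨fun z => f z.1, V', hV', hf.comp contDiffOn_fst h, rfl⟩⟩
  map_one' := rfl
  map_zero' := rfl
  map_mul' := by rintro ⟨_, f, V, hV, hf, rfl⟩ ⟨_, g, V', hV', hg, rfl⟩; rfl
  map_add' := by rintro ⟨_, f, V, hV, hf, rfl⟩ ⟨_, g, V', hV', hg, rfl⟩; rfl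

/-- The function `b` of `x` is the result of substituting `y = y₀` into `a`: some representative of
`a`, smooth on a dense open subset `V` of `W`, is defined at `(x, y₀)` for a dense set of `x`, and
`b(x) = a(x, y₀)`. -/
def IsSubst {W : Opens (ℝ × ℝ)} (a : Coef W) (y₀ : ℝ) (b : Coef (xProj W)) : Prop :=
  ∃ (f : ℝ × ℝ → ℝ) (V : Opens (ℝ × ℝ)), DenseIn V W ∧ ContDiffOn ℝ ∞ f V ∧
    (a : Germ (generic W) ℝ) = (f : Germ (generic W) ℝ) ∧
    (xProj W : Set ℝ) ⊆ closure {x | (x, y₀) ∈ V} ∧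
    (b : Germ (generic (xProj W)) ℝ) = ((fun x => f (x, y₀) : ℝ → ℝ) : Germ (generic (xProj W)) ℝ)

/-! ### Linear ordinary differential operators in `D = d/dx` -/

/-- The operator `a₀ + a₁ D + ⋯ + aₙ Dⁿ` with coefficients in `A`, stored as the list of its
coefficients.  Addition is that of polynomials; composition is `LODO.comp`, not the (commutative)
product of polynomials.  The order is `Polynomial.natDegree`. -/
abbrev LODO (A : Type*) [CommRing A] : Type _ := A[X]

section Operators

variable {A : Type*} [CommRing A] [Differential A]

/-- `D ∘ Q`, by the rule `D ∘ b = b D + b'`. -/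
def LODO.dComp (Q : LODO A) : LODO A :=
  Polynomial.X * Q + Q.sum fun i b => Polynomial.monomial i (Differential.deriv b)

/-- The composition `(∑ aᵢ Dⁱ) ∘ Q = ∑ aᵢ (Dⁱ ∘ Q)`. -/
def LODO.comp (P Q : LODO A) : LODO A :=
  P.sum fun i a => Polynomial.C a * LODO.dComp^[i] Q

/-- Composition of operators. -/
infixr:70 " ⊚ " => LODO.comp

/-- `IsRGCD F G B P Q`: the Euclidean algorithm with right division, applied to `F` and `G`,
terminates with the right greatest common divisor `B`, and reverse substitution gives
`B = P F + Q G`.  Each divisor has an invertible leading coefficient (over a field: is nonzero). -/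
inductive IsRGCD : LODO A → LODO A → LODO A → LODO A → LODO A → Prop
  | finish {F G T : LODO A} (hG : IsUnit G.leadingCoeff) (hF : F = T ⊚ G) : IsRGCD F G G 0 1
  | step {F G T H B P Q : LODO A} (hG : IsUnit G.leadingCoeff) (hF : F = T ⊚ G + H) (hH : H ≠ 0)
      (hdeg : H.degree < G.degree) (h : IsRGCD G H B P Q) : IsRGCD F G B Q (P - Q ⊚ T)

end Operators

/-- An operator with coefficients depending on `x` alone. -/
abbrev XOp (W : Opens (ℝ × ℝ)) : Type := LODO (Coef (xProj W))

/-- An operator with coefficients depending on `(x, y)`. -/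
abbrev XYOp (W : Opens (ℝ × ℝ)) : Type := LODO (Coef W)

section Plane

variable {W : Opens (ℝ × ℝ)}

/-- An operator `R(x)` regarded as an operator with coefficients on the plane domain. -/
def lift (R : XOp W) : XYOp W := R.map (ofX W)

/-- `F(x) = L(x, y₀)`. -/
def SubstOp (L : XYOp W) (y₀ : ℝ) (F : XOp W) : Prop :=
  ∀ i, IsSubst (L.coeff i) y₀ (F.coeff i)

/-- The function `L(x, y) φ(x)`. -/
def applyXY (L : XYOp W) (φ : ℝ → ℝ) : Germ (generic W) ℝ :=
  L.sum fun i a => (a : Germ (generic W) ℝ) *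
    ((fun z : ℝ × ℝ => iteratedDeriv i φ z.1 : ℝ × ℝ → ℝ) : Germ (generic W) ℝ)

/-- The function `R(x) φ(x)`. -/
def applyX (R : XOp W) (φ : ℝ → ℝ) : Germ (generic (xProj W)) ℝ :=
  R.sum fun i a => (a : Germ (generic (xProj W)) ℝ) *
    (iteratedDeriv i φ : Germ (generic (xProj W)) ℝ)

/-- Columns of arbitrary smooth functions of `x`. -/
def SmoothColumn (W : Opens (ℝ × ℝ)) {k : ℕ} (φ : Fin k → ℝ → ℝ) : Prop :=
  ∀ j, ContDiffOn ℝ ∞ (φ j) (xProj W)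

/-- `φ` lies in the kernel of the multiintegral `L₁ φ₁ + ⋯ + L_k φ_k`. -/
def InMultiKernel {k : ℕ} (L : Fin k → XYOp W) (φ : Fin k → ℝ → ℝ) : Prop :=
  SmoothColumn W φ ∧ ∑ j, applyXY (L j) (φ j) = 0

/-- `φ` lies in the kernel of the operator matrix `R`. -/
def InMatrixKernel {p k : ℕ} (R : Fin p → Fin k → XOp W) (φ : Fin k → ℝ → ℝ) : Prop :=
  SmoothColumn W φ ∧ ∀ i, ∑ j, applyX (R i j) (φ j) = 0

/-- The multiintegral vanishes identically only if all `φⱼ` vanish identically. -/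
def KernelIrreducible {k : ℕ} (L : Fin k → XYOp W) : Prop :=
  ∀ φ : Fin k → ℝ → ℝ, InMultiKernel L φ → ∀ j, ∀ x ∈ xProj W, φ j x = 0

/-! ### Algorithm RI -/

/-- A finite list of points `yᵢ` together with operators `Pᵢ(x)`. -/
abbrev Points (W : Opens (ℝ × ℝ)) : Type := List (ℝ × XOp W)

/-- The loop of algorithm RI on `L`: `B(x)` is the right greatest common divisor of
`L(x, y₁), …, L(x, yₛ)`, computed by successive Euclidean algorithms, and the `Pᵢ(x)` are the
cofactors found by reverse substitution.  The loop goes on only while `B` has positive order and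
is not a right divisor of `L(x, y)`. -/
inductive RILoop (L : XYOp W) : Points W → XOp W → Prop
  | start {y : ℝ} {F : XOp W} (hF : SubstOp L y F) (hu : IsUnit F.leadingCoeff) :
      RILoop L [(y, 1)] F
  | next {pts : Points W} {y : ℝ} {F B B' P Q : XOp W} (h : RILoop L pts B)
      (hpos : 0 < B.natDegree) (hdvd : ¬ ∃ M : XYOp W, L = M ⊚ lift B)
      (hF : SubstOp L y F) (hgcd : IsRGCD F B B' P Q) :
      RILoop L ((y, P) :: pts.map fun q => (q.1, Q ⊚ q.2)) B'

/-- `RI L pts M R`: a run of algorithm RI on the nonzero operator `L(x, y)` yields the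
decomposition `L(x, y) = M(x, y) R(x)`, with the points `yᵢ` and the operators `Pᵢ(x)` in `pts`.
Either the right greatest common divisor has order zero (it is then normalized to `1`, and `M = L`,
`R = 1`), or it divides `L(x, y)` on the right and is taken for `R(x)`. -/
inductive RI (L : XYOp W) : Points W → XYOp W → XOp W → Prop
  | coprime {pts : Points W} {b c : Coef (xProj W)} (h : RILoop L pts (Polynomial.C b))
      (hc : c * b = 1) : RI L (pts.map fun q => (q.1, Polynomial.C c ⊚ q.2)) L 1
  | divides {pts : Points W} {B : XOp W} {M : XYOp W} (h : RILoop L pts B)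
      (hM : L = M ⊚ lift B) : RI L pts M B

/-! ### Algorithm RMI -/

/-- `T(x) = ∑ᵢ Pᵢ(x) N(x, yᵢ)`. -/
def CombAt (N : XYOp W) : Points W → XOp W → Prop
  | [], T => T = 0
  | q :: l, T => ∃ F T' : XOp W, SubstOp N q.1 F ∧ CombAt N l T' ∧ T = q.2 ⊚ F + T'

/-- Elimination of an operator `L` against the irreducible operators `K₁, …, K_p` found so far:
starting from `N = L`, for `i = 1, …, p` put `Tᵢ(x) = ∑ₗ P_{i,l}(x) N(x, y_{i,l})` and replace `N`
by `N - Kᵢ Tᵢ`; the final `N` is the remainder. -/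
def Elim {p : ℕ} (K : Fin p → XYOp W) (pts : Fin p → Points W) (L : XYOp W)
    (T : Fin p → XOp W) (N : XYOp W) : Prop :=
  ∃ n : Fin (p + 1) → XYOp W, n 0 = L ∧ n (Fin.last p) = N ∧
    ∀ i : Fin p, CombAt (n i.castSucc) (pts i) (T i) ∧
      n i.succ = n i.castSucc - K i ⊚ lift (T i)

/-- `v` with the entry `a` appended. -/
def append {α : Type*} {n : ℕ} (v : Fin n → α) (a : α) : Fin (n + 1) → α :=
  Fin.snoc (α := fun _ => α) v a

/-- A run of algorithm RMI on the row `L₁, …, L_k`, column after column.  `M` and `R` are the row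
`M₁, …, M_p` and the `p × k` matrix of the decomposition.  The remaining data are kept during the
work: the irreducible operators `Kᵢ` given by RI (`K₁ = M₁`), their points and operators `P_{i,l}`,
and the arbitrarily chosen operators `S_{iq}(x)`, `i < q`.

For a new operator `L`, `Elim` gives `T` and a remainder `N`.  If `N = 0`, the number of rows does
not change (`skip`).  Otherwise RI gives `N = K R_{p+1}` with the new pivot `R_{p+1}`, the `Sᵢ` are
chosen arbitrarily, and `M_{p+1} = ∑ Kᵢ Sᵢ + K` (`pivot`).  In both cases the entries `rᵢ` of the
new column are determined, from the last to the first, by `rᵢ + ∑_{q > i} S_{iq} r_q = Tᵢ`. -/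
inductive RMIRun : {k p : ℕ} → (L : Fin k → XYOp W) → (K : Fin p → XYOp W) →
    (pts : Fin p → Points W) → (S : Fin p → Fin p → XOp W) → (M : Fin p → XYOp W) →
    (R : Fin p → Fin k → XOp W) → Prop
  | nil : RMIRun (k := 0) (p := 0) Fin.elim0 Fin.elim0 Fin.elim0 Fin.elim0 Fin.elim0 Fin.elim0
  | skip {k p : ℕ} {L : Fin k → XYOp W} {K : Fin p → XYOp W} {pts : Fin p → Points W}
      {S : Fin p → Fin p → XOp W} {M : Fin p → XYOp W} {R : Fin p → Fin k → XOp W}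
      {L' : XYOp W} {T r : Fin p → XOp W}
      (h : RMIRun L K pts S M R) (hT : Elim K pts L' T 0)
      (hr : ∀ i, r i + ∑ q ∈ Finset.Ioi i, S i q ⊚ r q = T i) :
      RMIRun (append L L') K pts S M (fun i => append (R i) (r i))
  | pivot {k p : ℕ} {L : Fin k → XYOp W} {K : Fin p → XYOp W} {pts : Fin p → Points W}
      {S : Fin p → Fin p → XOp W} {M : Fin p → XYOp W} {R : Fin p → Fin k → XOp W}
      {L' N K' : XYOp W} {T r s : Fin p → XOp W} {pts' : Points W} {R' : XOp W}
      (h : RMIRun L K pts S M R) (hT : Elim K pts L' T N) (hN : N ≠ 0) (hRI : RI N pts' K' R')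
      (hr : ∀ i, r i + ∑ q ∈ Finset.Ioi i, S i q ⊚ r q + s i ⊚ R' = T i) :
      RMIRun (append L L') (append K K') (append pts pts')
        (append (fun i => append (S i) (s i)) 0)
        (append M (∑ i, K i ⊚ lift (s i) + K'))
        (append (fun i => append (R i) (r i)) (append 0 R'))

/-- Algorithm RMI, applied to the operator row `L`, can output the operator row `M` and the matrix
`R`. -/
def RMI {k p : ℕ} (L : Fin k → XYOp W) (M : Fin p → XYOp W) (R : Fin p → Fin k → XOp W) : Prop :=
  ∃ (K : Fin p → XYOp W) (pts : Fin p → Points W) (S : Fin p → Fin p → XOp W),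
    RMIRun L K pts S M R

end Plane

end EulerIntegral

end

open scoped Polynomial ContDiff
open Filter TopologicalSpace

noncomputable section

namespace EulerIntegral

/-! ### The ring of differential operators and its action on coefficients. -/

namespace LODO

section Operators

variable {A : Type*} [CommRing A] [Differential A]

open Differential (deriv)

/-! Each list of points and operators gives a partial map `Λ(N) = ∑ Pₗ(x) ∘ N(x, yₗ)` (`CombAt`),
additive and commuting with right composition by operators in `x` alone. RI finds a combination with
`Λ(N) = B`. If `N = K ∘ B`, then `Λ(K) ∘ B = B`, and the invertible leading coefficient of `B` gives
`Λ(K) = 1` (`RI.spec`). The delicate point is that `K(x, yₗ)` must be shown to exist: its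
coefficients are recovered from those of `N(x, yₗ)` from the top down
(`SubstOp.exists_of_comp_lift`).

Elimination makes every earlier `Λᵢ` vanish on the remainder `K ∘ R`, hence on `K`. So `Λᵢ(Kᵢ) = 1`
and `Λᵢ(K_q) = 0` for `q > i` (`Separated`), and `∑ Kᵢ ψᵢ = 0` forces `ψ₁ = 0`, then `ψ₂ = 0`, and
so on. The row `M` is `K` times a unitriangular matrix, so `M ψ = 0` also forces `ψ = 0`. The
recursion for the entries of `R` is exactly what gives `L = M R` (`RMIRun.spec`). Therefore `L φ = M
(R φ)` vanishes iff `R φ` does.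

A function is handled as an operator of order zero: the zero-order coefficient of `P ∘ ψ` is `P ψ`.
-/

theorem coeff_dComp (Q : LODO A) (n : ℕ) :
    (dComp Q).coeff n = (Polynomial.X * Q).coeff n + deriv (Q.coeff n) := by
  rw [dComp, Polynomial.coeff_add, Polynomial.sum_def, Polynomial.finsetSum_coeff]
  congr 1
  simp only [Polynomial.coeff_monomial]
  rw [Finset.sum_ite_eq' Q.support n]
  split_ifs with h
  · rfl
  · rw [Polynomial.notMem_support_iff.1 h, map_zero]

theorem dComp_add (P Q : LODO A) : dComp (P + Q) = dComp P + dComp Q := by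
  ext n
  simp only [coeff_dComp, mul_add, Polynomial.coeff_add, map_add]
  ring

theorem dComp_C_mul (a : A) (Q : LODO A) :
    dComp (Polynomial.C a * Q) = Polynomial.C a * dComp Q + Polynomial.C (deriv a) * Q := by
  ext n
  rw [coeff_dComp, mul_left_comm]
  simp only [Polynomial.coeff_add, Polynomial.coeff_C_mul, coeff_dComp, Derivation.leibniz,
    smul_eq_mul]
  ring

theorem iterate_dComp_add (i : ℕ) (P Q : LODO A) :
    dComp^[i] (P + Q) = dComp^[i] P + dComp^[i] Q := by
  induction i generalizing P Q with
  | zero => rfl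
  | succ i ih => rw [Function.iterate_succ_apply, dComp_add, ih]; rfl

theorem comp_eq_sum_range (P Q : LODO A) {n : ℕ} (h : P.natDegree < n) :
    P ⊚ Q = ∑ i ∈ Finset.range n, Polynomial.C (P.coeff i) * dComp^[i] Q :=
  Polynomial.sum_over_range' P (fun i => by simp) n h

theorem add_comp (P P' Q : LODO A) : (P + P') ⊚ Q = P ⊚ Q + P' ⊚ Q :=
  Polynomial.sum_add_index P P' _ (fun i => by simp) (fun i a b => by rw [map_add, add_mul])

theorem comp_add (P Q Q' : LODO A) : P ⊚ (Q + Q') = P ⊚ Q + P ⊚ Q' := by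
  simp only [comp, iterate_dComp_add, mul_add]
  exact Polynomial.sum_add' P _ _

/-- Composition as a biadditive map. -/
def compHom : LODO A →+ LODO A →+ LODO A :=
  AddMonoidHom.mk' (fun P => AddMonoidHom.mk' (P ⊚ ·) (comp_add P))
    (fun P P' => AddMonoidHom.ext fun Q => add_comp P P' Q)

theorem zero_comp (Q : LODO A) : 0 ⊚ Q = 0 :=
  DFunLike.congr_fun (map_zero (compHom (A := A))) Q

theorem comp_zero (P : LODO A) : P ⊚ 0 = 0 := map_zero (compHom P)

theorem sub_comp (P P' Q : LODO A) : (P - P') ⊚ Q = P ⊚ Q - P' ⊚ Q :=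
  DFunLike.congr_fun (map_sub (compHom (A := A)) P P') Q

theorem comp_sub (P Q Q' : LODO A) : P ⊚ (Q - Q') = P ⊚ Q - P ⊚ Q' := map_sub (compHom P) Q Q'

theorem sum_comp {ι : Type*} (s : Finset ι) (P : ι → LODO A) (Q : LODO A) :
    (∑ i ∈ s, P i) ⊚ Q = ∑ i ∈ s, P i ⊚ Q :=
  map_sum ((compHom (A := A)).flip Q) P s

theorem comp_sum {ι : Type*} (s : Finset ι) (P : LODO A) (Q : ι → LODO A) :
    P ⊚ (∑ i ∈ s, Q i) = ∑ i ∈ s, P ⊚ Q i :=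
  map_sum (compHom P) Q s

theorem C_comp (a : A) (Q : LODO A) : Polynomial.C a ⊚ Q = Polynomial.C a * Q := by
  rw [comp, Polynomial.sum_C_index (by simp)]
  rfl

theorem one_comp (Q : LODO A) : 1 ⊚ Q = Q := by
  rw [← Polynomial.C_1, C_comp, Polynomial.C_1, one_mul]

theorem monomial_comp (i : ℕ) (a : A) (Q : LODO A) :
    Polynomial.monomial i a ⊚ Q = Polynomial.C a * dComp^[i] Q :=
  Polynomial.sum_monomial_index a _ (by simp)

theorem comp_one (P : LODO A) : P ⊚ 1 = P := by
  have h (i : ℕ) : dComp^[i] (1 : LODO A) = Polynomial.X ^ i := by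
    induction i with
    | zero => rfl
    | succ i ih =>
      rw [Function.iterate_succ_apply', ih, ← Polynomial.monomial_one_right_eq_X_pow, dComp,
        Polynomial.X_mul_monomial, Polynomial.sum_monomial_index _ _ (by simp),
        show deriv (1 : A) = 0 from Derivation.map_one_eq_zero _, map_zero, add_zero,
        Polynomial.monomial_one_right_eq_X_pow]
  simp only [comp, h]
  exact Polynomial.sum_C_mul_X_pow_eq P

theorem C_mul_comp (a : A) (P Q : LODO A) :
    (Polynomial.C a * P) ⊚ Q = Polynomial.C a * (P ⊚ Q) := by
  induction P using Polynomial.induction_on' with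
  | add p q hp hq => rw [mul_add, add_comp, hp, hq, add_comp, mul_add]
  | monomial n b =>
    rw [Polynomial.C_mul_monomial, monomial_comp, monomial_comp, map_mul, mul_assoc]

theorem dComp_monomial (n : ℕ) (b : A) :
    dComp (Polynomial.monomial n b) =
      Polynomial.monomial (n + 1) b + Polynomial.monomial n (deriv b) := by
  rw [dComp, Polynomial.X_mul_monomial, Polynomial.sum_monomial_index b _ (by simp)]

/-- The Leibniz rule enters here, through `dComp_C_mul`; associativity follows by iteration. -/
theorem dComp_comp (P Q : LODO A) : dComp (P ⊚ Q) = dComp P ⊚ Q := by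
  induction P using Polynomial.induction_on' with
  | add p q hp hq => rw [add_comp, dComp_add, hp, hq, dComp_add, add_comp]
  | monomial n b =>
    rw [dComp_monomial, add_comp, monomial_comp, monomial_comp, monomial_comp, dComp_C_mul,
      Function.iterate_succ_apply']

theorem iterate_dComp_comp (i : ℕ) (P Q : LODO A) : dComp^[i] (P ⊚ Q) = dComp^[i] P ⊚ Q := by
  induction i with
  | zero => rfl
  | succ i ih => simp only [Function.iterate_succ_apply', ih, dComp_comp]

theorem comp_assoc (P Q R : LODO A) : (P ⊚ Q) ⊚ R = P ⊚ (Q ⊚ R) := by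
  induction P using Polynomial.induction_on' with
  | add p q hp hq => rw [add_comp, add_comp, hp, hq, add_comp]
  | monomial n b => rw [monomial_comp, monomial_comp, C_mul_comp, iterate_dComp_comp]

/-! ### Coefficients of a composition -/

theorem coeff_iterate_dComp_eq_zero {Q : LODO A} {n : ℕ} (hQ : ∀ j, n < j → Q.coeff j = 0)
    (i : ℕ) : ∀ j, i + n < j → (dComp^[i] Q).coeff j = 0 := by
  induction i with
  | zero => simpa using hQ
  | succ i ih =>
    intro j hj
    obtain ⟨j, rfl⟩ : ∃ l, j = l + 1 := ⟨j - 1, by omega⟩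
    rw [Function.iterate_succ_apply', coeff_dComp, Polynomial.coeff_X_mul, ih j (by omega),
      ih (j + 1) (by omega), map_zero, add_zero]

theorem coeff_iterate_dComp {Q : LODO A} {n : ℕ} (hQ : ∀ j, n < j → Q.coeff j = 0)
    (i : ℕ) : (dComp^[i] Q).coeff (i + n) = Q.coeff n := by
  induction i with
  | zero => simp
  | succ i ih =>
    rw [Function.iterate_succ_apply', coeff_dComp, add_right_comm, Polynomial.coeff_X_mul, ih,
      coeff_iterate_dComp_eq_zero hQ i _ (by omega), map_zero, add_zero]

/-- Moving `D` past a coefficient only adds terms of lower order. Degree bounds suffice, so the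
degree of a lifted operator need not be known. -/
theorem coeff_comp_top {P Q : LODO A} {m n : ℕ} (hP : P.natDegree ≤ m) (hQ : Q.natDegree ≤ n) :
    (P ⊚ Q).coeff (m + n) = P.coeff m * Q.coeff n := by
  have hQ : ∀ j, n < j → Q.coeff j = 0 := Polynomial.natDegree_le_iff_coeff_eq_zero.1 hQ
  rw [comp_eq_sum_range P Q (Nat.lt_succ_of_le hP), Finset.sum_range_succ, Polynomial.coeff_add,
    Polynomial.coeff_C_mul, coeff_iterate_dComp hQ, Polynomial.finsetSum_coeff,
    Finset.sum_eq_zero, zero_add]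
  intro i hi
  rw [Polynomial.coeff_C_mul, coeff_iterate_dComp_eq_zero hQ i _
    (Nat.add_lt_add_right (Finset.mem_range.1 hi) _), mul_zero]

/-- Coefficient rings may have zero divisors, so cancellation needs a unit as leading coefficient.
-/
theorem eq_zero_of_comp_eq_zero {P Q : LODO A} (hQ : IsUnit Q.leadingCoeff) (h : P ⊚ Q = 0) :
    P = 0 := by
  have := coeff_comp_top (le_refl P.natDegree) (le_refl Q.natDegree)
  rw [h, Polynomial.coeff_zero] at this
  exact Polynomial.leadingCoeff_eq_zero.1 (hQ.mul_left_eq_zero.1 this.symm)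

/-- The value of an operator at a function. -/
def act (P : LODO A) (a : A) : A := P.sum fun i c => c * (deriv : A → A)^[i] a

theorem coeff_zero_iterate_dComp (i : ℕ) (Q : LODO A) :
    (dComp^[i] Q).coeff 0 = (deriv : A → A)^[i] (Q.coeff 0) := by
  induction i with
  | zero => rfl
  | succ i ih =>
    rw [Function.iterate_succ_apply', coeff_dComp, Polynomial.coeff_X_mul_zero, zero_add, ih,
      Function.iterate_succ_apply']

/-- The zero-order coefficient is the value at the function `1`. -/
theorem coeff_zero_comp (P Q : LODO A) : (P ⊚ Q).coeff 0 = act P (Q.coeff 0) := by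
  rw [comp, act, Polynomial.sum_def, Polynomial.sum_def, Polynomial.finsetSum_coeff]
  simp only [Polynomial.coeff_C_mul, coeff_zero_iterate_dComp]

theorem coeff_zero_comp_C (P : LODO A) (a : A) : (P ⊚ Polynomial.C a).coeff 0 = act P a := by
  rw [coeff_zero_comp, Polynomial.coeff_C_zero]

theorem act_zero (P : LODO A) : act P 0 = 0 := by
  rw [← coeff_zero_comp_C, map_zero, comp_zero, Polynomial.coeff_zero]

theorem comp_act (P Q : LODO A) (a : A) : act (P ⊚ Q) a = act P (act Q a) := by
  rw [← coeff_zero_comp_C, comp_assoc, coeff_zero_comp, coeff_zero_comp_C]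

theorem sum_act {ι : Type*} (s : Finset ι) (P : ι → LODO A) (a : A) :
    act (∑ i ∈ s, P i) a = ∑ i ∈ s, act (P i) a := by
  simp only [← coeff_zero_comp_C, sum_comp, Polynomial.finsetSum_coeff]

theorem act_sum {ι : Type*} (s : Finset ι) (P : LODO A) (a : ι → A) :
    act P (∑ i ∈ s, a i) = ∑ i ∈ s, act P (a i) := by
  simp only [← coeff_zero_comp_C, comp_sum, map_sum, Polynomial.finsetSum_coeff]

/-! ### Change of the ring of coefficients -/

variable {A' : Type*} [CommRing A'] [Differential A'] {f : A →+* A'}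

theorem map_dComp (hf : ∀ a, f (deriv a) = deriv (f a)) (Q : LODO A) :
    (dComp Q).map f = dComp (Q.map f) := by
  ext n
  rw [Polynomial.coeff_map, coeff_dComp, coeff_dComp, map_add, hf, Polynomial.coeff_map,
    ← Polynomial.coeff_map, Polynomial.map_mul, Polynomial.map_X]

theorem map_iterate_dComp (hf : ∀ a, f (deriv a) = deriv (f a)) (i : ℕ) (Q : LODO A) :
    (dComp^[i] Q).map f = dComp^[i] (Q.map f) := by
  induction i with
  | zero => rfl
  | succ i ih =>
    rw [Function.iterate_succ_apply', map_dComp hf, ih, Function.iterate_succ_apply']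

theorem map_comp (hf : ∀ a, f (deriv a) = deriv (f a)) (P Q : LODO A) :
    (P ⊚ Q).map f = P.map f ⊚ Q.map f := by
  induction P using Polynomial.induction_on' with
  | add p q hp hq => simp only [add_comp, Polynomial.map_add, hp, hq]
  | monomial n b =>
    rw [monomial_comp, Polynomial.map_mul, Polynomial.map_C, map_iterate_dComp hf,
      Polynomial.map_monomial, monomial_comp]

theorem map_act (hf : ∀ a, f (deriv a) = deriv (f a)) (P : LODO A) (a : A) :
    f (act P a) = act (P.map f) (f a) := by
  rw [← coeff_zero_comp_C, ← Polynomial.coeff_map, map_comp hf, Polynomial.map_C,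
    coeff_zero_comp_C]

end Operators

end LODO

/-- Reverse substitution: put `H = F - T ∘ G` into `B = P ∘ G + Q ∘ H`. -/
theorem IsRGCD.eq_comb {A : Type*} [CommRing A] [Differential A] {F G B P Q : LODO A}
    (h : IsRGCD F G B P Q) : IsUnit B.leadingCoeff ∧ B = P ⊚ F + Q ⊚ G := by
  induction h with
  | finish hG hF => exact ⟨hG, by rw [LODO.zero_comp, LODO.one_comp, zero_add]⟩
  | step hG hF hH hdeg h ih =>
    refine ⟨ih.1, ih.2.trans ?_⟩
    rw [hF, LODO.sub_comp, LODO.comp_add, LODO.comp_assoc]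
    abel

open Differential (deriv)

/-! ### Substitution of `y = y₀` in coefficients and operators. -/

section Substitution

variable {W : Opens (ℝ × ℝ)} {y : ℝ}

theorem denseIn_slice {V : Opens (ℝ × ℝ)} (hV : V ≤ W)
    (h : (xProj W : Set ℝ) ⊆ closure {x | (x, y) ∈ V}) :
    DenseIn (V.comap ⟨fun x : ℝ => (x, y), by fun_prop⟩) (xProj W) :=
  ⟨fun x hx => ⟨(x, y), hV hx, rfl⟩, h⟩

/-- The horizontal line at height `y` meets `W` in a dense subset of the projection of `W`. -/
def DenseSlice (W : Opens (ℝ × ℝ)) (y : ℝ) : Prop :=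
  (xProj W : Set ℝ) ⊆ closure {x | (x, y) ∈ W}

namespace IsSubst

variable {a a' : Coef W} {b b' : Coef (xProj W)}

theorem denseSlice (h : IsSubst a y b) : DenseSlice W y := by
  obtain ⟨f, V, hV, -, -, h, -⟩ := h
  exact h.trans (closure_mono fun x hx => hV.1 hx)

/-- Two representatives agree on a dense open set that may miss the line at height `y`; continuity
extends the equality to the common domain, and so to the line. -/
theorem unique (h : IsSubst a y b) (h' : IsSubst a y b') : b = b' := by
  obtain ⟨f, V, hV, hf, hfa, hs, hb⟩ := h
  obtain ⟨g, V', hV', hg, hg', hs', hb'⟩ := h'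
  refine Subtype.ext ?_
  rw [hb, hb']
  refine Germ.coe_eq.2 ⟨_, (denseIn_slice hV.1 hs).inf (denseIn_slice hV'.1 hs'), fun x hx => ?_⟩
  obtain ⟨U, hU, hfg⟩ := Germ.coe_eq.1 (hfa.symm.trans hg')
  have key : Set.EqOn f g (V ⊓ V' : Opens (ℝ × ℝ)) :=
    Set.EqOn.of_subset_closure (s := (U ⊓ (V ⊓ V') : Opens (ℝ × ℝ))) (fun z hz => hfg hz.1)
      (hf.continuousOn.mono fun _ h => h.1) (hg.continuousOn.mono fun _ h => h.2)
      (fun z hz => hz.2) fun z hz => (hU.inf (hV.inf hV')).2 (hV.1 hz.1)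
  exact key hx

theorem add (h : IsSubst a y b) (h' : IsSubst a' y b') : IsSubst (a + a') y (b + b') := by
  obtain ⟨f, V, hV, hf, hfa, hs, hb⟩ := h
  obtain ⟨g, V', hV', hg, hga, hs', hb'⟩ := h'
  exact ⟨f + g, V ⊓ V', hV.inf hV', (hf.mono fun _ h => h.1).add (hg.mono fun _ h => h.2),
    by rw [Subring.coe_add, hfa, hga]; rfl,
    ((denseIn_slice hV.1 hs).inf (denseIn_slice hV'.1 hs')).2,
    by rw [Subring.coe_add, hb, hb']; rfl⟩

theorem sub (h : IsSubst a y b) (h' : IsSubst a' y b') : IsSubst (a - a') y (b - b') := by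
  obtain ⟨f, V, hV, hf, hfa, hs, hb⟩ := h
  obtain ⟨g, V', hV', hg, hga, hs', hb'⟩ := h'
  exact ⟨f - g, V ⊓ V', hV.inf hV', (hf.mono fun _ h => h.1).sub (hg.mono fun _ h => h.2),
    by rw [AddSubgroupClass.coe_sub, hfa, hga]; rfl,
    ((denseIn_slice hV.1 hs).inf (denseIn_slice hV'.1 hs')).2,
    by rw [AddSubgroupClass.coe_sub, hb, hb']; rfl⟩

theorem mul (h : IsSubst a y b) (h' : IsSubst a' y b') : IsSubst (a * a') y (b * b') := by
  obtain ⟨f, V, hV, hf, hfa, hs, hb⟩ := h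
  obtain ⟨g, V', hV', hg, hga, hs', hb'⟩ := h'
  exact ⟨f * g, V ⊓ V', hV.inf hV', (hf.mono fun _ h => h.1).mul (hg.mono fun _ h => h.2),
    by rw [Subring.coe_mul, hfa, hga]; rfl,
    ((denseIn_slice hV.1 hs).inf (denseIn_slice hV'.1 hs')).2,
    by rw [Subring.coe_mul, hb, hb']; rfl⟩

theorem deriv (h : IsSubst a y b) : IsSubst (deriv a) y (deriv b) := by
  obtain ⟨f, V, hV, hf, hfa, hs, hb⟩ := h
  refine ⟨fun z => fderiv ℝ f z (1, 0), V, hV,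
    (hf.fderiv_of_isOpen V.isOpen (by simp)).clm_apply contDiffOn_const, ?_, hs, ?_⟩
  · show germDeriv W (1, 0) a = _
    rw [hfa]; rfl
  · show germDeriv (xProj W) 1 b = _
    rw [hb]
    refine Germ.coe_eq.2 ⟨_, denseIn_slice hV.1 hs, fun x hx => ?_⟩
    have h1 : DifferentiableAt ℝ f (x, y) :=
      (hf.differentiableOn (by simp)).differentiableAt (V.isOpen.mem_nhds hx)
    have h2 := h1.hasFDerivAt.comp x (hasFDerivAt_prodMk_left (𝕜 := ℝ) x y)
    show fderiv ℝ (fun x => f (x, y)) x 1 = _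
    rw [show (fun x => f (x, y)) = f ∘ (fun x => (x, y)) from rfl, h2.fderiv]
    simp

theorem ofX (hy : DenseSlice W y) (b : Coef (xProj W)) : IsSubst (ofX W b) y b := by
  obtain ⟨_, f, V, hV, hf, rfl⟩ := b
  have hU : DenseIn (W.comap ⟨fun x : ℝ => (x, y), by fun_prop⟩ ⊓ V) (xProj W) :=
    (denseIn_slice le_rfl hy).inf hV
  refine ⟨fun z => f z.1, W ⊓ V.comap ⟨Prod.fst, continuous_fst⟩,
    ⟨inf_le_left, fun z hz => mem_closure_iff.2 fun O hO hzO => ?_⟩,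
    hf.comp contDiffOn_fst fun z hz => hz.2, rfl, hU.2, rfl⟩
  obtain ⟨_, ⟨p, hp, rfl⟩, hV'⟩ := mem_closure_iff.1 (hV.2 ⟨z, hz, rfl⟩) (Prod.fst '' (O ∩ W))
    (isOpenMap_fst _ (hO.inter W.isOpen)) ⟨z, ⟨hzO, hz⟩, rfl⟩
  exact ⟨p, hp.1, hp.2, hV'⟩

theorem zero (hy : DenseSlice W y) : IsSubst (0 : Coef W) y 0 := by
  simpa only [map_zero] using IsSubst.ofX hy 0

end IsSubst

theorem ofX_deriv (b : Coef (xProj W)) : ofX W (deriv b) = deriv (ofX W b) := by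
  obtain ⟨_, f, V, hV, hf, rfl⟩ := b
  refine Subtype.ext (Germ.coe_eq.2 ?_)
  filter_upwards [tendsto_fst_generic W (show (V : Set ℝ) ∈ _ from ⟨V, hV, subset_rfl⟩)] with z hz
  have h1 : DifferentiableAt ℝ f z.1 :=
    (hf.differentiableOn (by simp)).differentiableAt (V.isOpen.mem_nhds hz)
  have h2 := h1.hasFDerivAt.comp z hasFDerivAt_fst
  show fderiv ℝ f z.1 1 = fderiv ℝ (f ∘ Prod.fst) z (1, 0)
  rw [h2.fderiv]
  simp

theorem lift_comp (P Q : XOp W) : lift (P ⊚ Q) = lift P ⊚ lift Q := LODO.map_comp ofX_deriv P Q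

theorem lift_one : lift (1 : XOp W) = 1 := Polynomial.map_one _

theorem lift_zero : lift (0 : XOp W) = 0 := Polynomial.map_zero _

theorem lift_add (P Q : XOp W) : lift (P + Q) = lift P + lift Q := Polynomial.map_add _

theorem lift_sum {ι : Type*} (s : Finset ι) (P : ι → XOp W) :
    lift (∑ i ∈ s, P i) = ∑ i ∈ s, lift (P i) := Polynomial.map_sum _ _ _

theorem lift_C (b : Coef (xProj W)) : lift (Polynomial.C b) = Polynomial.C (ofX W b) :=
  Polynomial.map_C _

namespace SubstOp

variable {L L' : XYOp W} {F F' : XOp W}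

theorem denseSlice (h : SubstOp L y F) : DenseSlice W y := (h 0).denseSlice

theorem unique (h : SubstOp L y F) (h' : SubstOp L y F') : F = F' :=
  Polynomial.ext fun i => (h i).unique (h' i)

theorem add (h : SubstOp L y F) (h' : SubstOp L' y F') : SubstOp (L + L') y (F + F') :=
  fun i => by simpa only [Polynomial.coeff_add] using (h i).add (h' i)

theorem sub (h : SubstOp L y F) (h' : SubstOp L' y F') : SubstOp (L - L') y (F - F') :=
  fun i => by simpa only [Polynomial.coeff_sub] using (h i).sub (h' i)

theorem lift (hy : DenseSlice W y) (F : XOp W) : SubstOp (lift F) y F :=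
  fun i => by simpa only [EulerIntegral.lift, Polynomial.coeff_map] using IsSubst.ofX hy _

theorem zero (hy : DenseSlice W y) : SubstOp (0 : XYOp W) y 0 := by
  simpa only [lift_zero] using SubstOp.lift hy 0

theorem C_mul {a : Coef W} {b : Coef (xProj W)} (h : IsSubst a y b) (h' : SubstOp L y F) :
    SubstOp (Polynomial.C a * L) y (Polynomial.C b * F) :=
  fun i => by simpa only [Polynomial.coeff_C_mul] using h.mul (h' i)

theorem dComp (h : SubstOp L y F) : SubstOp (LODO.dComp L) y (LODO.dComp F) := by
  intro i
  rw [LODO.coeff_dComp, LODO.coeff_dComp]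
  refine IsSubst.add ?_ (h i).deriv
  cases i with
  | zero => simpa only [Polynomial.coeff_X_mul_zero] using IsSubst.zero h.denseSlice
  | succ i => simpa only [Polynomial.coeff_X_mul] using h i

theorem iterate_dComp (h : SubstOp L y F) (i : ℕ) :
    SubstOp (LODO.dComp^[i] L) y (LODO.dComp^[i] F) := by
  induction i with
  | zero => exact h
  | succ i ih =>
    rw [Function.iterate_succ_apply', Function.iterate_succ_apply']
    exact ih.dComp

theorem comp (h : SubstOp L y F) (h' : SubstOp L' y F') : SubstOp (L ⊚ L') y (F ⊚ F') := by
  -- The order may drop under substitution, so both compositions are summed up to a common bound.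
  rw [LODO.comp_eq_sum_range L L' (Nat.lt_succ_of_le (le_max_left _ F.natDegree)),
    LODO.comp_eq_sum_range F F' (Nat.lt_succ_of_le (le_max_right L.natDegree _))]
  induction (max L.natDegree F.natDegree).succ with
  | zero => exact SubstOp.zero h.denseSlice
  | succ n ih =>
    rw [Finset.sum_range_succ, Finset.sum_range_succ]
    exact ih.add (C_mul (h n) (h'.iterate_dComp n))

theorem monomial (hy : DenseSlice W y) {a : Coef W} {b : Coef (xProj W)} (h : IsSubst a y b)
    (n : ℕ) : SubstOp (Polynomial.monomial n a) y (Polynomial.monomial n b) := by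
  intro i
  simp only [Polynomial.coeff_monomial]
  split_ifs
  · exact h
  · exact IsSubst.zero hy

/-- If a right divisor `B(x)` has an invertible leading coefficient, then `y` can be substituted
into the quotient wherever it can be substituted into the dividend. -/
theorem exists_of_comp_lift {B : XOp W} (hB : IsUnit B.leadingCoeff) (K : XYOp W)
    (h : SubstOp (K ⊚ EulerIntegral.lift B) y F) : ∃ G, SubstOp K y G ∧ F = G ⊚ B := by
  have hy := h.denseSlice
  suffices ∃ G, SubstOp K y G by
    obtain ⟨G, hG⟩ := this
    exact ⟨G, hG, h.unique (hG.comp (SubstOp.lift hy B))⟩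
  obtain ⟨c, hc⟩ := hB.exists_right_inv
  have hlead (m : ℕ) (K : XYOp W) (hK : K.natDegree ≤ m) :
      (K ⊚ EulerIntegral.lift B).coeff (m + B.natDegree) = K.coeff m * ofX W B.leadingCoeff := by
    rw [EulerIntegral.lift, LODO.coeff_comp_top hK Polynomial.natDegree_map_le,
      Polynomial.coeff_map, Polynomial.leadingCoeff]
  -- Induction on a strict bound for `degree`, so that the base case is `K = 0`.
  suffices ∀ (m : ℕ) (K : XYOp W) (F : XOp W), K.degree < m →
      SubstOp (K ⊚ EulerIntegral.lift B) y F → ∃ G, SubstOp K y G from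
    this (K.natDegree + 1) K F (Polynomial.degree_le_natDegree.trans_lt
      (by exact_mod_cast Nat.lt_succ_self _)) h
  intro m
  induction m with
  | zero =>
    intro K F hK _
    rw [Polynomial.degree_lt_iff_coeff_zero] at hK
    obtain rfl : K = 0 := Polynomial.ext fun i => hK i (Nat.zero_le i)
    exact ⟨0, SubstOp.zero hy⟩
  | succ m ih =>
    intro K F hK h
    rw [Polynomial.degree_lt_iff_coeff_zero] at hK
    -- The top coefficient of `K ∘ B` is that of `K` times the unit with inverse `c`; multiplying by
    -- `c` isolates it. Its monomial is then split off.
    have hk : IsSubst (K.coeff m) y (F.coeff (m + B.natDegree) * c) := by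
      have := (h (m + B.natDegree)).mul (IsSubst.ofX hy c)
      rwa [hlead m K (Polynomial.natDegree_le_iff_coeff_eq_zero.2 fun i hi => hK i hi), mul_assoc,
        ← map_mul, hc, map_one, mul_one] at this
    have hm := SubstOp.monomial hy hk m
    obtain ⟨G, hG⟩ := ih (K - Polynomial.monomial m (K.coeff m)) _
      (by
        rw [Polynomial.degree_lt_iff_coeff_zero]
        intro i hi
        rw [Polynomial.coeff_sub, Polynomial.coeff_monomial]
        split_ifs with him
        · rw [him, sub_self]
        · rw [hK i (by omega), sub_zero])
      (by rw [LODO.sub_comp]; exact h.sub (hm.comp (SubstOp.lift hy B)))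
    exact ⟨_, by simpa only [sub_add_cancel] using hG.add hm⟩

end SubstOp

end Substitution

variable {W : Opens (ℝ × ℝ)}

/-! ### Combinations of substitutions -/

namespace CombAt

variable {N N' : XYOp W} {l : Points W} {T T' : XOp W}

theorem add (h : CombAt N l T) (h' : CombAt N' l T') : CombAt (N + N') l (T + T') := by
  induction l generalizing T T' with
  | nil => rw [show T = 0 from h, show T' = 0 from h', add_zero]; rfl
  | cons q l ih =>
    obtain ⟨F, U, hF, hU, rfl⟩ := h
    obtain ⟨F', U', hF', hU', rfl⟩ := h'
    exact ⟨F + F', U + U', hF.add hF', ih hU hU', by rw [LODO.comp_add]; abel⟩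

theorem comp_lift (h : CombAt N l T) (B : XOp W) : CombAt (N ⊚ lift B) l (T ⊚ B) := by
  induction l generalizing T with
  | nil => rw [show T = 0 from h, LODO.zero_comp]; rfl
  | cons q l ih =>
    obtain ⟨F, U, hF, hU, rfl⟩ := h
    exact ⟨F ⊚ B, U ⊚ B, hF.comp (SubstOp.lift hF.denseSlice B), ih hU,
      by rw [LODO.add_comp, LODO.comp_assoc]⟩

theorem sub (h : CombAt N l T) (h' : CombAt N' l T') : CombAt (N - N') l (T - T') := by
  -- Negation is right composition with the constant `-1`.
  have := h.add (h'.comp_lift (Polynomial.C (-1)))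
  have e1 : N' ⊚ lift (Polynomial.C (-1)) = -N' := by
    rw [lift_C, map_neg, map_one, map_neg, map_one, ← zero_sub, LODO.comp_sub, LODO.comp_zero,
      LODO.comp_one, zero_sub]
  have e2 : T' ⊚ Polynomial.C (-1) = -T' := by
    rw [map_neg, map_one, ← zero_sub, LODO.comp_sub, LODO.comp_zero, LODO.comp_one, zero_sub]
  rwa [e1, e2, ← sub_eq_add_neg, ← sub_eq_add_neg] at this

/-- Even for the zero operator the lines through the points must meet `W` densely; any `N` with a
combination guarantees this. -/
theorem zero (h : CombAt N l T) : CombAt (0 : XYOp W) l 0 := by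
  simpa only [sub_self] using h.sub h

theorem sum {ι : Type*} {s : Finset ι} {N : ι → XYOp W} {T : ι → XOp W}
    (h0 : CombAt (0 : XYOp W) l 0) (h : ∀ i ∈ s, CombAt (N i) l (T i)) :
    CombAt (∑ i ∈ s, N i) l (∑ i ∈ s, T i) := by
  classical
  induction s using Finset.induction_on with
  | empty => exact h0
  | insert i s hi ih =>
    rw [Finset.sum_insert hi, Finset.sum_insert hi]
    exact (h i (Finset.mem_insert_self _ _)).add (ih fun j hj => h j (Finset.mem_insert_of_mem hj))

theorem unique (h : CombAt N l T) (h' : CombAt N l T') : T = T' := by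
  induction l generalizing T T' with
  | nil => exact Eq.trans h (Eq.symm h')
  | cons q l ih =>
    obtain ⟨F, U, hF, hU, rfl⟩ := h
    obtain ⟨F', U', hF', hU', rfl⟩ := h'
    rw [hF.unique hF', ih hU hU']

theorem exists_of_comp_lift {B : XOp W} (hB : IsUnit B.leadingCoeff)
    (h : CombAt (N ⊚ lift B) l T) : ∃ U, CombAt N l U ∧ T = U ⊚ B := by
  induction l generalizing T with
  | nil => exact ⟨0, rfl, by rw [show T = 0 from h, LODO.zero_comp]⟩
  | cons q l ih =>
    obtain ⟨F, T', hF, hT', rfl⟩ := h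
    obtain ⟨G, hG, rfl⟩ := SubstOp.exists_of_comp_lift hB N hF
    obtain ⟨U, hU, rfl⟩ := ih hT'
    exact ⟨q.2 ⊚ G + U, ⟨G, U, hG, hU, rfl⟩, by rw [LODO.add_comp, LODO.comp_assoc]⟩

theorem comp_left (h : CombAt N l T) (Q : XOp W) :
    CombAt N (l.map fun q => (q.1, Q ⊚ q.2)) (Q ⊚ T) := by
  induction l generalizing T with
  | nil => rw [show T = 0 from h, LODO.comp_zero]; rfl
  | cons q l ih =>
    obtain ⟨F, U, hF, hU, rfl⟩ := h
    exact ⟨F, Q ⊚ U, hF, ih hU, by rw [LODO.comp_add, LODO.comp_assoc]⟩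

/-- This carries combinations from operators to functions: the zero-order coefficient of `Q ∘ F`
depends on `F` only through that of `F`. -/
theorem coeff_zero (h : CombAt N l T) (hN : N.coeff 0 = 0) : T.coeff 0 = 0 := by
  induction l generalizing T with
  | nil => rw [show T = 0 from h, Polynomial.coeff_zero]
  | cons q l ih =>
    obtain ⟨F, U, hF, hU, rfl⟩ := h
    have : F.coeff 0 = 0 := (hF 0).unique (hN ▸ IsSubst.zero hF.denseSlice)
    rw [Polynomial.coeff_add, LODO.coeff_zero_comp, this, LODO.act_zero, ih hU, add_zero]

end CombAt

/-! ### Algorithm RI -/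

theorem RILoop.combAt {L : XYOp W} {pts : Points W} {B : XOp W} (h : RILoop L pts B) :
    IsUnit B.leadingCoeff ∧ CombAt L pts B := by
  induction h with
  | start hF hu =>
    exact ⟨hu, _, 0, hF, rfl, by rw [LODO.one_comp, add_zero]⟩
  | next h hpos hdvd hF hgcd ih =>
    exact ⟨hgcd.eq_comb.1, _, _, hF, ih.2.comp_left _, hgcd.eq_comb.2⟩

theorem RI.spec {L M : XYOp W} {pts : Points W} {R : XOp W} (h : RI L pts M R) :
    IsUnit R.leadingCoeff ∧ L = M ⊚ lift R ∧ CombAt M pts 1 := by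
  cases h with
  | @coprime _ b c h hc =>
    refine ⟨by rw [Polynomial.leadingCoeff_one]; exact isUnit_one,
      by rw [lift_one, LODO.comp_one], ?_⟩
    have := h.combAt.2.comp_left (Polynomial.C c)
    rwa [LODO.C_comp, ← map_mul, hc, map_one] at this
  | divides h hM =>
    obtain ⟨hB, hL⟩ := h.combAt
    refine ⟨hB, hM, ?_⟩
    rw [hM] at hL
    -- `U` is the combination for `M`; `U ∘ B = B` yields `U = 1`.
    obtain ⟨U, hU, hUB⟩ := CombAt.exists_of_comp_lift hB hL
    have : U - 1 = 0 := LODO.eq_zero_of_comp_eq_zero hB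
      (by rw [LODO.sub_comp, LODO.one_comp, ← hUB, sub_self])
    rwa [sub_eq_zero.1 this] at hU

/-! ### Algorithm RMI -/

/-- The operators `Kᵢ(x, y)` are separated by their points: the combination for `Kᵢ` gives `1` on
`Kᵢ` and `0` on the later operators. -/
def Separated {p : ℕ} (K : Fin p → XYOp W) (pts : Fin p → Points W) : Prop :=
  ∀ i, CombAt (K i) (pts i) 1 ∧ ∀ q, i < q → CombAt (K q) (pts i) 0

/-- Step `i` changes the `i`-th combination from `Tᵢ` to `Tᵢ - Tᵢ = 0`; later steps subtract
multiples of operators on which it is zero. -/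
theorem Elim.combAt {p : ℕ} {K : Fin p → XYOp W} {pts : Fin p → Points W} {L N : XYOp W}
    {T : Fin p → XOp W} (hK : Separated K pts) (h : Elim K pts L T N) (i : Fin p) :
    CombAt N (pts i) 0 := by
  obtain ⟨n, -, rfl, hn⟩ := h
  suffices ∀ m : Fin (p + 1), i.castSucc < m → CombAt (n m) (pts i) 0 from
    this _ (Fin.castSucc_lt_last i)
  intro m
  induction m using Fin.induction with
  | zero => exact fun h => absurd h (Fin.not_lt_zero _)
  | succ j ih =>
    intro hij
    rw [(hn j).2]
    rcases (Fin.castSucc_lt_succ_iff.1 hij).eq_or_lt with rfl | hlt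
    · have := (hn i).1.sub ((hK i).1.comp_lift (T i))
      rwa [LODO.one_comp, sub_self] at this
    · have := (ih (Fin.castSucc_lt_castSucc_iff.2 hlt)).sub (((hK i).2 j hlt).comp_lift (T j))
      rwa [LODO.zero_comp, sub_self] at this

theorem Elim.eq_sum {p : ℕ} {K : Fin p → XYOp W} {pts : Fin p → Points W} {L N : XYOp W}
    {T : Fin p → XOp W} (h : Elim K pts L T N) : L = ∑ i, K i ⊚ lift (T i) + N := by
  obtain ⟨n, rfl, rfl, hn⟩ := h
  have h1 (i : Fin p) : K i ⊚ lift (T i) = n i.castSucc - n i.succ := by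
    rw [(hn i).2, sub_sub_cancel]
  -- Telescoping: the sum of all `n` split at its first and at its last term.
  have h2 := (Fin.sum_univ_succ n).symm.trans (Fin.sum_univ_castSucc n)
  rw [Finset.sum_congr rfl fun i _ => h1 i, Finset.sum_sub_distrib]
  linear_combination h2

theorem Separated.append {p : ℕ} {K : Fin p → XYOp W} {pts : Fin p → Points W} {K' : XYOp W}
    {pts' : Points W} (hK : Separated K pts) (h1 : CombAt K' pts' 1)
    (h0 : ∀ i, CombAt K' (pts i) 0) : Separated (append K K') (append pts pts') := by
  intro i
  induction i using Fin.lastCases with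
  | last =>
    refine ⟨by simpa only [EulerIntegral.append, Fin.snoc_last] using h1, fun q hq => ?_⟩
    exact absurd hq (Fin.le_last q).not_gt
  | cast i =>
    refine ⟨by simpa only [EulerIntegral.append, Fin.snoc_castSucc] using (hK i).1, fun q hq => ?_⟩
    induction q using Fin.lastCases with
    | last => simpa only [EulerIntegral.append, Fin.snoc_castSucc, Fin.snoc_last] using h0 i
    | cast q =>
      simpa only [EulerIntegral.append, Fin.snoc_castSucc] using
        (hK i).2 q (Fin.castSucc_lt_castSucc_iff.1 hq)

/-- Once the earlier `ψ` vanish, the `i`-th combination kills the later terms and returns `ψ i`. -/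
theorem Separated.eq_zero {p : ℕ} {K : Fin p → XYOp W} {pts : Fin p → Points W}
    (hK : Separated K pts) {ψ : Fin p → Coef (xProj W)}
    (h : ∑ i, LODO.act (K i) (ofX W (ψ i)) = 0) (i : Fin p) : ψ i = 0 := by
  induction i using WellFoundedLT.induction with
  | ind i ih =>
    have hsum : ∑ q ∈ Finset.Ici i, LODO.act (K q) (ofX W (ψ q)) = 0 := by
      rw [← h]
      refine Finset.sum_subset (Finset.subset_univ _) fun q _ hq => ?_
      rw [ih q (not_le.1 fun hiq => hq (Finset.mem_Ici.2 hiq)), map_zero, LODO.act_zero]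
    -- This operator need not vanish; only its zero-order coefficient is known to.
    have hcomb : CombAt (∑ q ∈ Finset.Ici i, K q ⊚ lift (Polynomial.C (ψ q))) (pts i)
        (∑ q ∈ Finset.Ici i, if q = i then Polynomial.C (ψ q) else 0) := by
      refine CombAt.sum (hK i).1.zero fun q hq => ?_
      split_ifs with hqi
      · subst hqi
        simpa only [LODO.one_comp] using (hK q).1.comp_lift (Polynomial.C (ψ q))
      · simpa only [LODO.zero_comp] using
          ((hK i).2 q (lt_of_le_of_ne (Finset.mem_Ici.1 hq) (Ne.symm hqi))).comp_lift
            (Polynomial.C (ψ q))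
    have := hcomb.coeff_zero (by
      simpa only [Polynomial.finsetSum_coeff, lift_C, LODO.coeff_zero_comp_C] using hsum)
    rwa [Finset.sum_ite_eq', if_pos (Finset.mem_Ici.2 le_rfl), Polynomial.coeff_C_zero] at this

/-- The row `M` is the row `K` multiplied by the unitriangular matrix with the entries `S i q`
above the diagonal. -/
def IsUnitriangular {p : ℕ} (K : Fin p → XYOp W) (S : Fin p → Fin p → XOp W)
    (M : Fin p → XYOp W) : Prop :=
  ∀ q, M q = K q + ∑ i ∈ Finset.Iio q, K i ⊚ lift (S i q)

namespace IsUnitriangular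

variable {p : ℕ} {K M : Fin p → XYOp W} {S : Fin p → Fin p → XOp W}

theorem sum_comp (h : IsUnitriangular K S M) (r : Fin p → XOp W) :
    ∑ q, M q ⊚ lift (r q) = ∑ i, K i ⊚ lift (r i + ∑ q ∈ Finset.Ioi i, S i q ⊚ r q) := by
  have h1 (q : Fin p) : M q ⊚ lift (r q) =
      K q ⊚ lift (r q) + ∑ i ∈ Finset.Iio q, K i ⊚ lift (S i q ⊚ r q) := by
    rw [h q, LODO.add_comp, LODO.sum_comp]
    simp only [lift_comp, LODO.comp_assoc]
  have h2 (i : Fin p) : K i ⊚ lift (r i + ∑ q ∈ Finset.Ioi i, S i q ⊚ r q) =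
      K i ⊚ lift (r i) + ∑ q ∈ Finset.Ioi i, K i ⊚ lift (S i q ⊚ r q) := by
    rw [lift_add, LODO.comp_add, lift_sum, LODO.comp_sum]
  simp only [h1, h2, Finset.sum_add_distrib]
  rw [Finset.sum_comm' (t' := Finset.univ) (s' := fun i => Finset.Ioi i) fun q i => by simp]

theorem sum_act (h : IsUnitriangular K S M) (ψ : Fin p → Coef (xProj W)) :
    ∑ q, LODO.act (M q) (ofX W (ψ q)) =
      ∑ i, LODO.act (K i) (ofX W (ψ i + ∑ q ∈ Finset.Ioi i, LODO.act (S i q) (ψ q))) := by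
  have := congrArg (Polynomial.coeff · 0) (h.sum_comp fun q => Polynomial.C (ψ q))
  simpa only [Polynomial.finsetSum_coeff, LODO.coeff_zero_comp, lift, Polynomial.coeff_map,
    Polynomial.coeff_add, Polynomial.coeff_C_zero] using this

/-- Back substitution from the last index. The `ψ` are coefficient classes, which allows `ψ = R φ`,
where smoothness is only generic. -/
theorem eq_zero (h : IsUnitriangular K S M) {pts : Fin p → Points W} (hK : Separated K pts)
    {ψ : Fin p → Coef (xProj W)} (hψ : ∑ q, LODO.act (M q) (ofX W (ψ q)) = 0) (i : Fin p) :
    ψ i = 0 := by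
  rw [h.sum_act] at hψ
  induction i using WellFoundedGT.induction with
  | ind i ih =>
    have := hK.eq_zero hψ i
    rwa [Finset.sum_eq_zero, add_zero] at this
    intro q hq
    rw [ih q (Finset.mem_Ioi.1 hq), LODO.act_zero]

theorem append (h : IsUnitriangular K S M) (K' : XYOp W) (s : Fin p → XOp W) :
    IsUnitriangular (append K K') (append (fun i => append (S i) (s i)) 0)
      (append M (∑ i, K i ⊚ lift (s i) + K')) := by
  intro q
  induction q using Fin.lastCases with
  | last =>
    have : Finset.Iio (Fin.last p) = Finset.univ.map Fin.castSuccEmb := by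
      ext i
      induction i using Fin.lastCases <;> simp
    simp only [EulerIntegral.append, this, Finset.sum_map, Fin.coe_castSuccEmb, Fin.snoc_last,
      Fin.snoc_castSucc]
    exact add_comm _ _
  | cast q =>
    have : Finset.Iio q.castSucc = (Finset.Iio q).map Fin.castSuccEmb := by
      ext i
      induction i using Fin.lastCases <;> simp
    simp only [EulerIntegral.append, this, Finset.sum_map, Fin.coe_castSuccEmb, Fin.snoc_castSucc]
    exact h q

end IsUnitriangular

theorem RMIRun.spec {k p : ℕ} {L : Fin k → XYOp W} {K : Fin p → XYOp W} {pts : Fin p → Points W}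
    {S : Fin p → Fin p → XOp W} {M : Fin p → XYOp W} {R : Fin p → Fin k → XOp W}
    (h : RMIRun L K pts S M R) :
    Separated K pts ∧ IsUnitriangular K S M ∧ ∀ j, L j = ∑ i, M i ⊚ lift (R i j) := by
  induction h with
  | nil => exact ⟨fun i => i.elim0, fun i => i.elim0, fun i => i.elim0⟩
  | skip h hT hr ih =>
    obtain ⟨hK, hM, hL⟩ := ih
    refine ⟨hK, hM, fun j => ?_⟩
    induction j using Fin.lastCases with
    | last =>
      simp only [append, Fin.snoc_last]
      rw [hM.sum_comp, hT.eq_sum, add_zero]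
      simp only [hr]
    | cast j => simpa only [append, Fin.snoc_castSucc] using hL j
  | @pivot k p L K pts S M R L' N K' T r s pts' R' h hT hN hRI hr ih =>
    obtain ⟨hK, hM, hL⟩ := ih
    obtain ⟨hR, hNK, hK'⟩ := hRI.spec
    refine ⟨hK.append hK' fun i => ?_, hM.append K' s, fun j => ?_⟩
    -- Each earlier combination vanishes on `N = K' ∘ R'`; cancelling `R'` shows that it vanishes on
    -- `K'`.
    · have := hT.combAt hK i
      rw [hNK] at this
      obtain ⟨U, hU, hUR⟩ := CombAt.exists_of_comp_lift hR this
      rwa [LODO.eq_zero_of_comp_eq_zero hR hUR.symm] at hU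
    · rw [Fin.sum_univ_castSucc]
      induction j using Fin.lastCases with
      | last =>
        simp only [append, Fin.snoc_last, Fin.snoc_castSucc]
        rw [hM.sum_comp, hT.eq_sum, hNK, LODO.add_comp, LODO.sum_comp, ← add_assoc,
          ← Finset.sum_add_distrib]
        simp only [LODO.comp_assoc, ← lift_comp, ← LODO.comp_add, ← lift_add, hr]
      | cast j =>
        simp only [append, Fin.snoc_last, Fin.snoc_castSucc]
        rw [hL j, Pi.zero_apply, lift_zero, LODO.comp_zero, add_zero]

/-! ### Kernels -/

/-- A smooth function of `x` as a coefficient function. -/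
def smoothCoef {φ : ℝ → ℝ} (hφ : ContDiffOn ℝ ∞ φ (xProj W)) : Coef (xProj W) :=
  ⟨(φ : Germ (generic (xProj W)) ℝ), φ, xProj W, DenseIn.refl _, hφ, rfl⟩

theorem coe_iterate_deriv_smoothCoef {φ : ℝ → ℝ} (hφ : ContDiffOn ℝ ∞ φ (xProj W)) (i : ℕ) :
    (((Differential.deriv : Coef (xProj W) → Coef (xProj W))^[i] (smoothCoef hφ) :
      Coef (xProj W)) : Germ (generic (xProj W)) ℝ) =
      (iteratedDeriv i φ : Germ (generic (xProj W)) ℝ) := by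
  induction i with
  | zero => rw [iteratedDeriv_zero]; rfl
  | succ i ih =>
    rw [Function.iterate_succ_apply', iteratedDeriv_succ]
    show germDeriv (xProj W) 1 _ = _
    rw [ih]
    -- `deriv f x` is by definition `fderiv ℝ f x 1`.
    rfl

theorem applyX_eq_act (R : XOp W) {φ : ℝ → ℝ} (hφ : ContDiffOn ℝ ∞ φ (xProj W)) :
    applyX R φ = (LODO.act R (smoothCoef hφ) : Coef (xProj W)) := by
  rw [applyX, LODO.act, Polynomial.sum_def, Polynomial.sum_def, AddSubmonoidClass.coe_finsetSum]
  simp only [Subring.coe_mul, coe_iterate_deriv_smoothCoef]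

theorem ofX_iterate_deriv (i : ℕ) (b : Coef (xProj W)) :
    ofX W ((Differential.deriv : Coef (xProj W) → Coef (xProj W))^[i] b) =
      (Differential.deriv : Coef W → Coef W)^[i] (ofX W b) := by
  induction i with
  | zero => rfl
  | succ i ih => rw [Function.iterate_succ_apply', ofX_deriv, ih, Function.iterate_succ_apply']

theorem applyXY_eq_act (L : XYOp W) {φ : ℝ → ℝ} (hφ : ContDiffOn ℝ ∞ φ (xProj W)) :
    applyXY L φ = (LODO.act L (ofX W (smoothCoef hφ)) : Coef W) := by
  have key (i : ℕ) : (((Differential.deriv : Coef W → Coef W)^[i] (ofX W (smoothCoef hφ)) :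
      Coef W) : Germ (generic W) ℝ) =
      ((fun z : ℝ × ℝ => iteratedDeriv i φ z.1 : ℝ × ℝ → ℝ) : Germ (generic W) ℝ) := by
    rw [← ofX_iterate_deriv]
    show Germ.compTendsto _ Prod.fst (tendsto_fst_generic W) = _
    rw [coe_iterate_deriv_smoothCoef]
    rfl
  rw [applyXY, LODO.act, Polynomial.sum_def, Polynomial.sum_def, AddSubmonoidClass.coe_finsetSum]
  simp only [Subring.coe_mul, key]

theorem sum_applyXY_eq_zero_iff {k : ℕ} (L : Fin k → XYOp W) {φ : Fin k → ℝ → ℝ}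
    (hφ : SmoothColumn W φ) : ∑ j, applyXY (L j) (φ j) = 0 ↔
      ∑ j, LODO.act (L j) (ofX W (smoothCoef (hφ j))) = 0 := by
  rw [Finset.sum_congr rfl fun j _ => applyXY_eq_act (L j) (hφ j),
    ← AddSubmonoidClass.coe_finsetSum, ZeroMemClass.coe_eq_zero]

theorem sum_applyX_eq_zero_iff {k : ℕ} (R : Fin k → XOp W) {φ : Fin k → ℝ → ℝ}
    (hφ : SmoothColumn W φ) : ∑ j, applyX (R j) (φ j) = 0 ↔
      ∑ j, LODO.act (R j) (smoothCoef (hφ j)) = 0 := by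
  rw [Finset.sum_congr rfl fun j _ => applyX_eq_act (R j) (hφ j),
    ← AddSubmonoidClass.coe_finsetSum, ZeroMemClass.coe_eq_zero]

theorem eq_zero_of_smoothCoef_eq_zero {φ : ℝ → ℝ} (hφ : ContDiffOn ℝ ∞ φ (xProj W))
    (h : smoothCoef hφ = 0) {x : ℝ} (hx : x ∈ xProj W) : φ x = 0 := by
  obtain ⟨V, hV, hφV⟩ := Germ.coe_eq.1 (congrArg Subtype.val h :
    (φ : Germ (generic (xProj W)) ℝ) = ((fun _ => 0 : ℝ → ℝ) : Germ (generic (xProj W)) ℝ))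
  have : Set.EqOn φ (fun _ => 0) (xProj W) :=
    Set.EqOn.of_subset_closure (s := V) (fun z hz => hφV hz) hφ.continuousOn continuousOn_const
      hV.1 hV.2
  exact this hx

end EulerIntegral

end

theorem mainTheorem7 (W : TopologicalSpace.Opens (ℝ × ℝ)) (k p : ℕ)
    (L : Fin k → EulerIntegral.XYOp W) (M : Fin p → EulerIntegral.XYOp W)
    (R : Fin p → Fin k → EulerIntegral.XOp W) (hRMI : EulerIntegral.RMI L M R) :
    EulerIntegral.KernelIrreducible M ∧
      ∀ φ : Fin k → ℝ → ℝ,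
        EulerIntegral.InMultiKernel L φ ↔ EulerIntegral.InMatrixKernel R φ := by
  open EulerIntegral in
  obtain ⟨K, pts, S, hrun⟩ := hRMI
  obtain ⟨hK, hM, hL⟩ := hrun.spec
  refine ⟨fun ψ hψ j x hx => ?_, fun φ => and_congr_right fun hφ => ?_⟩
  · exact eq_zero_of_smoothCoef_eq_zero (hψ.1 j)
      (hM.eq_zero hK ((sum_applyXY_eq_zero_iff M hψ.1).1 hψ.2) j) hx
  -- The factorization `L = M R`, applied to `φ`.
  · have key : ∑ j, LODO.act (L j) (ofX W (smoothCoef (hφ j))) =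
        ∑ i, LODO.act (M i) (ofX W (∑ j, LODO.act (R i j) (smoothCoef (hφ j)))) := by
      simp only [hL, LODO.sum_act, LODO.comp_act, map_sum, LODO.act_sum, lift,
        LODO.map_act ofX_deriv]
      exact Finset.sum_comm
    simp only [sum_applyX_eq_zero_iff _ hφ]
    rw [sum_applyXY_eq_zero_iff L hφ, key]
    refine ⟨hM.eq_zero hK, fun h => Finset.sum_eq_zero fun i _ => ?_⟩
    rw [h i, map_zero, LODO.act_zero]
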